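/- Let $\mathrm{Simp}(Grp)$ be the category of simplicial groups. For a simplicial group $X$ let $N(X)$ be its Moore complex, $N(X)_0=X_0$, $N(X)_k=\bigcap_{i=0}^{k-1}\ker(d_i\colon X_k\to X_{k-1})$ for $k\ge 1$, with differential the restriction of $d_k$. For $n\ge 0$ let $\mathcal M_{n\ge}$ (resp. $\mathcal M_{\ge n}$) be the full subcategory of those $X$ with $N(X)_i=0$ for all $i>n$ (resp. for all $i<n$). Let $\mathrm{Cot}_n\colon \mathrm{Simp}(Grp)\to \mathrm{Simp}(Grp)$ be the cotruncation functor: $\mathrm{Cot}_n(X)$ is the quotient of $X$ by the normal simplicial subgroup generated by the $N(X)_k$, $k>n$ (equivalently, $X\to \mathrm{Cot}_n(X)$ is the reflection of $X$ into $\mathcal M_{n\ge}$; in the semi-direct decomposition it deletes $N(X)_k$ for $k>n$ and replaces $N(X)_n$ by $N(X)_n/d_{n+1}(N(X)_{n+1})$). Put $\mathrm{Ker}(\mathrm{Cot}_n)=\{X\mid \mathrm{Cot}_n(X)\cong 0\}$. A torsion theory in a pointed category is a pair $(\mathcal T,\mathcal F)$ of full replete subcategories such that every morphism from an object of $\mathcal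 T$ to an object of $\mathcal F$ is zero, and every object $X$ sits in a short exact sequence $0\to T_X\to X\to F_X\to 0$ with $T_X\in\mathcal T$, $F_X\in\mathcal F$ (the first map is a kernel of the second and the second a cokernel of the first). Torsion theories are ordered by $(\mathcal T,\mathcal F)\le(\mathcal S,\mathcal G)$ iff $\mathcal T\subseteq\mathcal S$; the least one is $0=(0,\mathrm{Simp}(Grp))$ and the greatest one is $\mathrm{Simp}(Grp)=(\mathrm{Simp}(Grp),0)$. Theorem. For every $n\ge 0$ the pair $\mu_{n\ge}=(\mathrm{Ker}(\mathrm{Cot}_n),\mathcal M_{n\ge})$ is a torsion theory in $\mathrm{Simp}(Grp)$. For every $n\ge 0$ the pair $\mu_{\ge n+1}=(\mathcal T_{tr_n},\mathcal F_{tr_n})$ is a torsion theory, where $\mathcal T_{tr_n}=\{X\mid tr_n(X)\cong 0\}$ is defined by the truncation functor $tr_n$, and $\mathcal F_{tr_n}$ consists of the $X$ for which the unit $X\to cosk_n(tr_n(X))$ of $tr_n\dashv cosk_n$ is monic; moreover $\mathcal T_{tr_n}=\mathcal M_{\ge n+1}$. The torsion subcategories are linearly ordered: for every $n\ge 0$,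 $$0\subseteq \mathrm{Ker}(\mathrm{Cot}_{n+1})\subseteq \mathcal M_{\ge n+1}\subseteq \mathrm{Ker}(\mathrm{Cot}_n)\subseteq \mathcal M_{\ge n}\subseteq \mathrm{Simp}(Grp).$$ Moreover, the torsion theories $0$, $\mu_{n\ge}$, $\mu_{\ge n+1}$ ($n\ge 0$) and $\mathrm{Simp}(Grp)$ form a linearly ordered lattice $\mu(Grp)$, with least element $0$ and greatest element $\mathrm{Simp}(Grp)$ and with meets and joins as in the ordered class of all torsion theories in $\mathrm{Simp}(Grp)$: $$0\le\dots\le\mu_{n+1\ge}\le\mu_{\ge n+1}\le\mu_{n\ge}\le\dots\le\mu_{\ge 2}\le\mu_{1\ge}\le\mu_{\ge 1}\le\mu_{0\ge}\le \mathrm{Simp}(Grp).$$ -/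

import Mathlib

open CategoryTheory CategoryTheory.Limits Opposite
open scoped Simplicial

universe v u

/-! ### Torsion theories in a pointed category -/

section TorsionTheories

variable {C : Type u} [Category.{v} C] [HasZeroMorphisms C]

/-- `0 ⟶ K ⟶ X ⟶ Q ⟶ 0` is short exact: `k` is a kernel of `p` and `p` is a cokernel of `k`. -/
def IsShortExactSeq {K X Q : C} (k : K ⟶ X) (p : X ⟶ Q) : Prop :=
  ∃ w : k ≫ p = 0, Nonempty (IsLimit (KernelFork.ofι k w)) ∧
    Nonempty (IsColimit (CokernelCofork.ofπ p w))

variable (C) in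
/-- A torsion theory: a pair of full replete subcategories such that every morphism from a torsion
object to a torsion-free object is zero, and every object is an extension of a torsion-free object
by a torsion object. -/
structure TorsionTheory where
  torsion : ObjectProperty C
  torsionFree : ObjectProperty C
  torsion_replete : torsion.IsClosedUnderIsomorphisms
  torsionFree_replete : torsionFree.IsClosedUnderIsomorphisms
  hom_eq_zero : ∀ {T F : C}, torsion T → torsionFree F → ∀ f : T ⟶ F, f = 0
  exists_shortExact : ∀ X : C, ∃ (T F : C) (k : T ⟶ X) (p : X ⟶ F),
    torsion T ∧ torsionFree F ∧ IsShortExactSeq k p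

namespace TorsionTheory

theorem torsionFree_iff (τ : TorsionTheory C) (X : C) :
    τ.torsionFree X ↔ ∀ (T : C), τ.torsion T → ∀ f : T ⟶ X, f = 0 := by
  refine ⟨fun hX T hT f => τ.hom_eq_zero hT hX f, fun h => ?_⟩
  obtain ⟨T, F, k, p, hT, hF, w, -, ⟨hp⟩⟩ := τ.exists_shortExact X
  have hk : k = 0 := h T hT k
  let s : F ⟶ X := hp.desc (CokernelCofork.ofπ (𝟙 X) (by simp [hk]))
  have h1 : p ≫ s = 𝟙 X := hp.fac (CokernelCofork.ofπ (𝟙 X) (by simp [hk])) .one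
  have h2 : s ≫ p = 𝟙 F := by
    apply Cofork.IsColimit.hom_ext hp
    change p ≫ s ≫ p = p ≫ 𝟙 F
    rw [← Category.assoc, h1, Category.id_comp, Category.comp_id]
  exact τ.torsionFree_replete.of_iso ⟨s, p, h2, h1⟩ hF

theorem ext_torsion {τ σ : TorsionTheory C} (h : τ.torsion = σ.torsion) : τ = σ := by
  have h' : τ.torsionFree = σ.torsionFree := by
    funext X
    rw [eq_iff_iff, torsionFree_iff, torsionFree_iff, h]
  cases τ; cases σ; cases h; cases h'; rfl

/-- Torsion theories are ordered by inclusion of their torsion subcategories. -/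
instance : PartialOrder (TorsionTheory C) where
  le τ σ := τ.torsion ≤ σ.torsion
  le_refl τ := le_refl τ.torsion
  le_trans τ σ ρ h h' := le_trans (b := σ.torsion) h h'
  le_antisymm _ _ h h' := ext_torsion (le_antisymm h h')

/-- The bottom torsion theory `(0, C)`. -/
instance [HasZeroObject C] : OrderBot (TorsionTheory C) where
  bot :=
    { torsion := IsZero
      torsionFree := ⊤
      torsion_replete := ⟨fun e h => h.of_iso e.symm⟩
      torsionFree_replete := ⟨fun _ _ => trivial⟩
      hom_eq_zero := fun hT _ f => hT.eq_zero_of_src f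
      exists_shortExact := fun X => by
        obtain ⟨Z, hZ⟩ := HasZeroObject.zero (C := C)
        refine ⟨Z, X, 0, 𝟙 X, hZ, trivial, by simp, ⟨?_⟩, ⟨?_⟩⟩
        · exact KernelFork.IsLimit.ofι _ _ (fun _ _ => 0)
            (fun g w => by simpa using w.symm) (fun _ _ _ _ => hZ.eq_of_tgt _ _)
        · exact CokernelCofork.IsColimit.ofπ _ _ (fun g _ => g) (fun _ _ => by simp)
            (fun g w m h => by simpa using h) }
  bot_le τ := by
    intro X hX
    obtain ⟨T, F, k, p, hT, hF, w, ⟨hk⟩, -⟩ := τ.exists_shortExact X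
    refine τ.torsion_replete.of_iso (IsZero.iso ?_ hX) hT
    rw [IsZero.iff_id_eq_zero]
    apply Fork.IsLimit.hom_ext hk
    exact hX.eq_of_tgt _ _

/-- The top torsion theory `(C, 0)`. -/
instance [HasZeroObject C] : OrderTop (TorsionTheory C) where
  top :=
    { torsion := ⊤
      torsionFree := IsZero
      torsion_replete := ⟨fun _ _ => trivial⟩
      torsionFree_replete := ⟨fun e h => h.of_iso e.symm⟩
      hom_eq_zero := fun _ hF f => hF.eq_zero_of_tgt f
      exists_shortExact := fun X => by
        obtain ⟨Z, hZ⟩ := HasZeroObject.zero (C := C)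
        refine ⟨X, Z, 𝟙 X, 0, trivial, hZ, by simp, ⟨?_⟩, ⟨?_⟩⟩
        · exact KernelFork.IsLimit.ofι _ _ (fun g _ => g) (fun _ _ => by simp)
            (fun g w m h => by simpa using h)
        · exact CokernelCofork.IsColimit.ofπ _ _ (fun _ _ => 0)
            (fun g w => by simpa using w.symm) (fun _ _ _ _ => hZ.eq_of_src _ _) }
  le_top _ := fun _ _ => trivial

end TorsionTheory

end TorsionTheories

/-! ### Simplicial groups, Moore complexes and truncations -/

/-- The zero morphism of groups is the trivial homomorphism. -/
instance instHasZeroMorphismsGrpCat : HasZeroMorphisms GrpCat.{u} where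
  zero _ _ := ⟨GrpCat.ofHom 1⟩
  comp_zero _ _ := by ext; rfl
  zero_comp _ _ _ f := by ext; exact f.hom.map_one

/-- The category of simplicial groups. -/
abbrev SimpGrp : Type (u + 1) := SimplicialObject GrpCat.{u}

/-- The Moore complex of a simplicial group: `N(X)_0 = X_0` and `N(X)_n = ⋂_{i < n} ker d_i`. -/
def moore (X : SimpGrp.{u}) (n : ℕ) : Subgroup (X _⦋n⦌) :=
  match n with
  | 0 => ⊤
  | n + 1 => ⨅ i : Fin (n + 1), (X.δ i.castSucc).hom.ker

/-- `M_{n ≥}`: the Moore complex is trivial in dimensions greater than `n`. -/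
def MooreLE (n : ℕ) : ObjectProperty SimpGrp.{u} := fun X => ∀ i, n < i → moore X i = ⊥

/-- `M_{≥ n}`: the Moore complex is trivial in dimensions less than `n`. -/
def MooreGE (n : ℕ) : ObjectProperty SimpGrp.{u} := fun X => ∀ i, i < n → moore X i = ⊥

/-- `Ker(tr_n)`: the `n`-truncation is a zero object. -/
def KerTr (n : ℕ) : ObjectProperty SimpGrp.{u} :=
  fun X => IsZero ((SimplicialObject.truncation n).obj X)

/-- The simplicial groups `X` for which the unit `X ⟶ cosk_n (tr_n X)` is monic. -/
def MonoCoskUnit (n : ℕ) : ObjectProperty SimpGrp.{u} :=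
  fun X => Mono ((SimplicialObject.coskAdj n).unit.app X)

/-! ### The cotruncation functor -/

/-- The normal simplicial subgroup of `X` generated by the `N(X)_k` with `k > n`. In the semi-direct
decomposition of each `X_m` into degenerate copies of the `N(X)_k`, it consists of the copies of
`N(X)_k` for `k > n` and of the copies of `d_{n+1}(N(X)_{n+1}) ⊆ N(X)_n`. -/
def cotKer (n : ℕ) (X : SimpGrp.{u}) (m : SimplexCategoryᵒᵖ) : Subgroup (X.obj m) :=
  Subgroup.normalClosure
    {x | ∃ k, n < k ∧ ∃ f : op ⦋k⦌ ⟶ m, ∃ z ∈ moore X k, (X.map f).hom z = x}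

instance (n : ℕ) (X : SimpGrp.{u}) (m : SimplexCategoryᵒᵖ) : (cotKer n X m).Normal :=
  Subgroup.normalClosure_normal

theorem cotKer_le_comap_map (n : ℕ) (X : SimpGrp.{u}) {m m' : SimplexCategoryᵒᵖ} (f : m ⟶ m') :
    cotKer n X m ≤ (cotKer n X m').comap (X.map f).hom := by
  refine Subgroup.normalClosure_le_normal ?_
  rintro _ ⟨k, hk, g, z, hz, rfl⟩
  exact Subgroup.subset_normalClosure ⟨k, hk, g ≫ f, z, hz, by simp⟩

theorem moore_le_comap (n : ℕ) {X Y : SimpGrp.{u}} (φ : X ⟶ Y) :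
    moore X n ≤ (moore Y n).comap (φ.app (op ⦋n⦌)).hom := by
  cases n with
  | zero => exact fun _ _ => trivial
  | succ n =>
    intro x hx
    simp only [moore, Subgroup.mem_iInf, Subgroup.mem_comap, MonoidHom.mem_ker] at hx ⊢
    intro i
    have h := ConcreteCategory.congr_hom (φ.naturality (SimplexCategory.δ i.castSucc).op) x
    refine h.symm.trans ?_
    exact (congrArg (φ.app _).hom (hx i)).trans (map_one _)

theorem cotKer_le_comap_app (n : ℕ) {X Y : SimpGrp.{u}} (φ : X ⟶ Y) (m : SimplexCategoryᵒᵖ) :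
    cotKer n X m ≤ (cotKer n Y m).comap (φ.app m).hom := by
  refine Subgroup.normalClosure_le_normal ?_
  rintro _ ⟨k, hk, g, z, hz, rfl⟩
  refine Subgroup.subset_normalClosure ⟨k, hk, g, _, moore_le_comap k φ hz, ?_⟩
  exact (ConcreteCategory.congr_hom (φ.naturality g) z).symm

/-- The cotruncation functor `Cot_n` on simplicial groups: the quotient of `X` which kills the
`N(X)_k` for `k > n`, and hence replaces `N(X)_n` by `N(X)_n / d_{n+1}(N(X)_{n+1})`. -/
def cot (n : ℕ) : SimpGrp.{u} ⥤ SimpGrp.{u} where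
  obj X :=
    { obj := fun m => GrpCat.of (X.obj m ⧸ cotKer n X m)
      map := fun f => GrpCat.ofHom
        (QuotientGroup.map _ _ (X.map f).hom (cotKer_le_comap_map n X f))
      map_id := fun m => by
        ext x
        simp
      map_comp := fun f g => by
        ext x
        simp }
  map φ :=
    { app := fun m => GrpCat.ofHom
        (QuotientGroup.map _ _ (φ.app m).hom (cotKer_le_comap_app n φ m))
      naturality := fun m m' f => by
        ext x
        have h := ConcreteCategory.congr_hom (φ.naturality f) x
        exact congrArg (QuotientGroup.mk (s := cotKer n _ m')) h }
  map_id X := by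
    ext m x
    simp
  map_comp φ ψ := by
    ext m x
    simp

/-- `Ker(Cot_n)`: the simplicial groups whose cotruncation is a zero object. -/
def KerCot (n : ℕ) : ObjectProperty SimpGrp.{u} := fun X => IsZero ((cot n).obj X)

/-- The quotient map `X ⟶ Cot_n(X)`. -/
def cotUnit (n : ℕ) (X : SimpGrp.{u}) : X ⟶ (cot n).obj X where
  app m := GrpCat.ofHom (QuotientGroup.mk' (cotKer n X m))
  naturality _ _ _ := rfl

theorem mem_moore_succ (X : SimpGrp.{u}) (n : ℕ) (x : X _⦋n + 1⦌) :
    x ∈ moore X (n + 1) ↔ ∀ i : Fin (n + 1), (X.δ i.castSucc).hom x = 1 := by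
  simp [moore, Subgroup.mem_iInf, MonoidHom.mem_ker]

/-- `Cot_n(X)` lies in `M_{n ≥}`. -/
theorem mooreLE_cot (n : ℕ) (X : SimpGrp.{u}) : MooreLE n ((cot n).obj X) := by
  rintro (_ | k) hk
  · omega
  rw [eq_bot_iff]
  intro q hq
  obtain ⟨x, rfl⟩ := QuotientGroup.mk_surjective q
  replace hq := (mem_moore_succ ((cot n).obj X) k _).1 hq
  have hx : ∀ i : Fin (k + 1), (X.δ i.castSucc).hom x ∈ cotKer n X (op ⦋k⦌) :=
    fun i => (QuotientGroup.eq_one_iff _).1 (hq i)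
  -- correct `x` by elements of the kernel until its first `j` faces vanish
  have key : ∀ j : ℕ, j ≤ k + 1 → ∃ y ∈ cotKer n X (op ⦋k + 1⦌),
      ∀ i : Fin (k + 1), i.1 < j → (X.δ i.castSucc).hom (x * y) = 1 := by
    intro j
    induction j with
    | zero => exact fun _ => ⟨1, one_mem _, fun i hi => absurd hi (Nat.not_lt_zero _)⟩
    | succ j ih =>
      intro hj
      obtain ⟨y, hy, h⟩ := ih (by omega)
      let J : Fin (k + 1) := ⟨j, hj⟩
      let a : X _⦋k⦌ := (X.δ J.castSucc).hom (x * y)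
      have ha : a ∈ cotKer n X (op ⦋k⦌) := by
        have hy' := cotKer_le_comap_map n X (SimplexCategory.δ J.castSucc).op hy
        have := mul_mem (hx J) hy'
        have e : a = (X.δ J.castSucc).hom x * (X.δ J.castSucc).hom y := map_mul _ _ _
        rw [e]
        exact this
      have hw : (X.σ J).hom a ∈ cotKer n X (op ⦋k + 1⦌) :=
        cotKer_le_comap_map n X (SimplexCategory.σ J).op ha
      refine ⟨y * ((X.σ J).hom a)⁻¹, mul_mem hy (inv_mem hw), fun i hi => ?_⟩
      rw [← mul_assoc, map_mul, map_inv]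
      rcases Nat.lt_succ_iff_lt_or_eq.1 hi with hi | hi
      · rw [h i hi, one_mul, inv_eq_one]
        obtain _ | k := k
        · omega
        have hJ : J ≠ 0 := fun h0 => by simp [J, Fin.ext_iff] at h0; omega
        obtain ⟨J', hJ'⟩ := Fin.exists_succ_eq.2 hJ
        have hiJ : i ≤ J'.castSucc := by
          have := congrArg Fin.val hJ'
          simp [J] at this
          rw [Fin.le_def]; simp; omega
        have e1 := ConcreteCategory.congr_hom (X.δ_comp_σ_of_le hiJ) a
        rw [hJ'] at e1
        have hiJ2 : i ≤ J'.castSucc := hiJ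
        have hJs : J.castSucc = J'.castSucc.succ := by rw [← hJ']; rfl
        have e2 := ConcreteCategory.congr_hom (X.δ_comp_δ hiJ2) (x * y)
        rw [← hJs] at e2
        have e3 : (X.δ i).hom a = 1 := by
          refine e2.trans ?_
          exact (congrArg (X.δ J'.castSucc).hom (h i hi)).trans (map_one _)
        refine e1.trans ?_
        exact (congrArg (X.σ J').hom e3).trans (map_one _)
      · have hiJ : i = J := Fin.ext hi
        have e := ConcreteCategory.congr_hom (X.δ_comp_σ_self (i := J)) a
        rw [hiJ]
        rw [mul_inv_eq_one]
        exact e.symm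
  obtain ⟨y, hy, h⟩ := key (k + 1) le_rfl
  have hxy : x * y ∈ cotKer n X (op ⦋k + 1⦌) :=
    Subgroup.subset_normalClosure ⟨k + 1, hk, 𝟙 _, x * y,
      (mem_moore_succ X k _).2 fun i => h i i.2, by simp⟩
  refine (QuotientGroup.eq_one_iff _).2 ?_
  simpa using mul_mem hxy (inv_mem hy)

/-- `X ⟶ Cot_n(X)` is the reflection of `X` into `M_{n ≥}`. -/
theorem cot_universal (n : ℕ) {X Y : SimpGrp.{u}} (hY : MooreLE n Y) (φ : X ⟶ Y) :
    ∃! ψ : (cot n).obj X ⟶ Y, cotUnit n X ≫ ψ = φ := by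
  have hker : ∀ m, cotKer n X m ≤ (φ.app m).hom.ker := by
    intro m
    refine Subgroup.normalClosure_le_normal ?_
    rintro _ ⟨k, hk, f, z, hz, rfl⟩
    have h1 : (φ.app (op ⦋k⦌)).hom z = 1 := by
      have := moore_le_comap k φ hz
      rwa [hY k hk] at this
    refine (ConcreteCategory.congr_hom (φ.naturality f) z).trans ?_
    exact (congrArg (Y.map f).hom h1).trans (map_one _)
  refine ⟨{ app := fun m => GrpCat.ofHom (QuotientGroup.lift _ (φ.app m).hom (hker m))
            naturality := fun m m' f => ?_ }, ?_, fun ψ hψ => ?_⟩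
  · ext q
    obtain ⟨x, rfl⟩ := QuotientGroup.mk_surjective q
    exact ConcreteCategory.congr_hom (φ.naturality f) x
  · ext m x
    rfl
  · subst hψ
    ext m q
    obtain ⟨x, rfl⟩ := QuotientGroup.mk_surjective q
    rfl

/-! Two facts about the Moore complex carry the proof. Multiplying by degenerate elements makes all
faces except the last vanish, so each `X_m` is generated by degeneracies of Moore elements of
dimension at most `m` (`eq_top_of_moore_le`). Conversely, an operator that misses a vertex other
than the last kills Moore elements. Counting vertices, the kernel of `X ⟶ Cot_n(X)` is therefore
trivial below dimension `n` and consists of boundaries of `N(X)_{n+1}` in dimension `n`.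

Together these give `kerCot_iff`, which yields both the torsion theory of `Cot_n` and the inclusions
`M_{≥ n+1} ⊆ Ker(Cot_n) ⊆ M_{≥ n}`. For `tr_n`, the torsion part of `X` is the subgroup of elements
that every operator into dimension at most `n` kills. Since `Ker(tr_n) = M_{≥ n+1}`, the two
families interleave; in a chain, the smaller and larger of two elements are their meet and join in
any ambient order. -/

/-! ### Generation by the Moore complex -/

/-- A family of subgroups stable under degeneracies and faces, containing the Moore complex up to
dimension `m`, contains all of `X_m`. -/
theorem eq_top_of_moore_le (X : SimpGrp.{u}) (L : ∀ m : SimplexCategoryᵒᵖ, Subgroup (X.obj m))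
    (hL : ∀ {m m' : SimplexCategoryᵒᵖ} (f : m ⟶ m'), L m ≤ (L m').comap (X.map f).hom) :
    ∀ m : ℕ, (∀ j ≤ m, moore X j ≤ L (op ⦋j⦌)) → L (op ⦋m⦌) = ⊤ := by
  intro m
  induction m with
  | zero => exact fun h => eq_top_iff.2 (h 0 le_rfl)
  | succ k ih =>
    intro hm
    have hk : ∀ a : X _⦋k⦌, a ∈ L (op ⦋k⦌) := fun a => by
      rw [ih fun j hj => hm j (by omega)]; trivial
    rw [eq_top_iff]
    intro x _
    have key : ∀ j : ℕ, j ≤ k + 1 → ∃ y ∈ L (op ⦋k + 1⦌),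
        ∀ i : Fin (k + 1), i.1 < j → (X.δ i.castSucc).hom (x * y) = 1 := by
      intro j
      induction j with
      | zero => exact fun _ => ⟨1, one_mem _, fun i hi => absurd hi (Nat.not_lt_zero _)⟩
      | succ j ih =>
        intro hj
        obtain ⟨y, hy, h⟩ := ih (by omega)
        let J : Fin (k + 1) := ⟨j, hj⟩
        let a : X _⦋k⦌ := (X.δ J.castSucc).hom (x * y)
        have hw : (X.σ J).hom a ∈ L (op ⦋k + 1⦌) := hL (SimplexCategory.σ J).op (hk a)
        -- With `a = d_j(xy)`, `d_j s_j a = a` cancels the face `j`. For `i < j`, `d_i s_j a =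
        -- s_{j-1} d_i d_j(xy) = s_{j-1} d_{j-1} d_i(xy) = 1`, so the earlier faces stay trivial.
        refine ⟨y * ((X.σ J).hom a)⁻¹, mul_mem hy (inv_mem hw), fun i hi => ?_⟩
        rw [← mul_assoc, map_mul, map_inv]
        rcases Nat.lt_succ_iff_lt_or_eq.1 hi with hi | hi
        · rw [h i hi, one_mul, inv_eq_one]
          obtain _ | k := k
          · omega
          have hJ : J ≠ 0 := fun h0 => by simp [J, Fin.ext_iff] at h0; omega
          obtain ⟨J', hJ'⟩ := Fin.exists_succ_eq.2 hJ
          have hiJ : i ≤ J'.castSucc := by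
            have := congrArg Fin.val hJ'
            simp [J] at this
            rw [Fin.le_def]; simp; omega
          have e1 := ConcreteCategory.congr_hom (X.δ_comp_σ_of_le hiJ) a
          rw [hJ'] at e1
          have hJs : J.castSucc = J'.castSucc.succ := by rw [← hJ']; rfl
          have e2 := ConcreteCategory.congr_hom (X.δ_comp_δ hiJ) (x * y)
          rw [← hJs] at e2
          have e3 : (X.δ i).hom a = 1 :=
            e2.trans ((congrArg (X.δ J'.castSucc).hom (h i hi)).trans (map_one _))
          exact e1.trans ((congrArg (X.σ J').hom e3).trans (map_one _))
        · have hiJ : i = J := Fin.ext hi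
          rw [hiJ, mul_inv_eq_one]
          exact (ConcreteCategory.congr_hom (X.δ_comp_σ_self (i := J)) a).symm
    obtain ⟨y, hy, h⟩ := key (k + 1) le_rfl
    have hxy : x * y ∈ L (op ⦋k + 1⦌) :=
      hm (k + 1) le_rfl ((mem_moore_succ X k _).2 fun i => h i i.2)
    simpa using mul_mem hxy (inv_mem hy)

/-- The Moore complex vanishes up to dimension `n` iff the simplicial group does. -/
theorem mooreGE_succ_iff (n : ℕ) (X : SimpGrp.{u}) :
    MooreGE (n + 1) X ↔ ∀ m ≤ n, ∀ x : X _⦋m⦌, x = 1 := by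
  constructor
  · intro h m hm x
    -- The trivial subgroups are stable under all operators, so generation forces `⊥ = ⊤` in
    -- dimension `m`.
    have := eq_top_of_moore_le X (fun _ => ⊥) (fun f x hx => by
      rw [Subgroup.mem_bot] at hx
      simp [hx]) m (fun j hj => (h j (by omega)).le)
    have hx : x ∈ (⊥ : Subgroup (X _⦋m⦌)) := this ▸ Subgroup.mem_top x
    exact hx
  · exact fun h m hm => (Subgroup.eq_bot_iff_forall _).2 fun x _ => h m (by omega) x

theorem isZero_functor_grpCat_iff {J : Type*} [Category* J] (F : J ⥤ GrpCat.{u}) :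
    IsZero F ↔ ∀ (j : J) (x : F.obj j), x = 1 := by
  rw [Functor.isZero_iff]
  refine forall_congr' fun j => ⟨fun h x => ?_, fun h => ?_⟩
  · have := GrpCat.subsingleton_of_isZero h
    exact Subsingleton.elim _ _
  · have : Subsingleton (F.obj j) := ⟨fun x y => (h x).trans (h y).symm⟩
    exact GrpCat.isZero_of_subsingleton _

theorem kerTr_eq_mooreGE (n : ℕ) : KerTr.{u} n = MooreGE (n + 1) := by
  funext X
  rw [eq_iff_iff, mooreGE_succ_iff, KerTr, isZero_functor_grpCat_iff]
  exact ⟨fun h m hm x => h (op ⟨⦋m⦌, hm⟩) x, fun h j x => h j.unop.obj.len j.unop.property x⟩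

/-! ### The Moore complex of the kernel of the cotruncation -/

/-- An operator missing some vertex other than the last one kills the Moore complex. -/
theorem map_eq_one_of_mem_moore (X : SimpGrp.{u}) {k j : ℕ} {z : X _⦋k + 1⦌}
    (hz : z ∈ moore X (k + 1)) (f : ⦋j⦌ ⟶ ⦋k + 1⦌) (i : Fin (k + 1))
    (hi : ∀ t, f t ≠ i.castSucc) : (X.map f.op).hom z = 1 := by
  obtain ⟨g, rfl⟩ := SimplexCategory.eq_comp_δ_of_not_surjective' f i.castSucc hi
  rw [op_comp, X.map_comp]
  exact (congrArg (X.map g.op).hom ((mem_moore_succ X k z).1 hz i)).trans (map_one _)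

/-- Pigeonhole: `j + 1` vertices cannot cover the `k + 1` vertices other than the last. -/
theorem exists_castSucc_ne_of_lt {k j : ℕ} (h : j < k) (f : ⦋j⦌ ⟶ ⦋k + 1⦌) :
    ∃ i : Fin (k + 1), ∀ t, f t ≠ i.castSucc := by
  by_contra! hf
  choose t ht using hf
  have hinj : Function.Injective t := fun a b hab =>
    Fin.castSucc_injective _ ((ht a).symm.trans ((congrArg f hab).trans (ht b)))
  have := Fintype.card_le_of_injective t hinj
  simp at this
  omega

/-- Either `f` misses a vertex other than the last and the image is trivial, or `k = n + 1` and `f`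
is the last coface. -/
theorem map_mem_map_moore (X : SimpGrp.{u}) {n k : ℕ} (hk : n < k) {z : X _⦋k⦌}
    (hz : z ∈ moore X k) (f : ⦋n⦌ ⟶ ⦋k⦌) :
    (X.map f.op).hom z ∈ (moore X (n + 1)).map (X.δ (Fin.last (n + 1))).hom := by
  obtain _ | k := k
  · omega
  by_cases h : ∃ i : Fin (k + 1), ∀ t, f t ≠ i.castSucc
  · obtain ⟨i, hi⟩ := h
    rw [map_eq_one_of_mem_moore X hz f i hi]
    exact one_mem _
  obtain rfl : n = k := by
    by_contra hne
    exact h (exists_castSucc_ne_of_lt (by omega) f)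
  push Not at h
  choose t ht using h
  have hinj : Function.Injective t := fun a b hab =>
    Fin.castSucc_injective _ ((ht a).symm.trans ((congrArg f hab).trans (ht b)))
  have hsurj : Function.Surjective t := Finite.surjective_of_injective hinj
  -- As `t` is bijective, `f` never takes the last value. It factors through the last coface by a
  -- surjective endomorphism, which must be the identity.
  obtain ⟨g, rfl⟩ := SimplexCategory.eq_comp_δ_of_not_surjective' f (Fin.last _) (fun s => by
    obtain ⟨i, rfl⟩ := hsurj s
    exact (ht i).trans_ne (Fin.castSucc_lt_last i).ne)
  have hg : Epi g := by
    rw [SimplexCategory.epi_iff_surjective]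
    intro i
    refine ⟨t i, ?_⟩
    have := ht i
    apply Fin.succAbove_right_injective (p := Fin.last _)
    rw [Fin.succAbove_last_apply i]
    exact this
  rw [SimplexCategory.eq_id_of_epi g, Category.id_comp]
  exact Subgroup.mem_map_of_mem _ hz

theorem eq_one_of_mem_cotKer {n j : ℕ} (hj : j < n) (X : SimpGrp.{u}) {x : X _⦋j⦌}
    (hx : x ∈ cotKer n X (op ⦋j⦌)) : x = 1 := by
  have : cotKer n X (op ⦋j⦌) ≤ ⊥ := by
    refine Subgroup.normalClosure_le_normal ?_
    rintro _ ⟨k, hk, f, z, hz, rfl⟩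
    obtain _ | k := k
    · omega
    obtain ⟨i, hi⟩ := exists_castSucc_ne_of_lt (by omega) f.unop
    exact map_eq_one_of_mem_moore X hz f.unop i hi
  exact this hx

instance normal_moore (X : SimpGrp.{u}) (n : ℕ) : (moore X n).Normal := by
  cases n with
  | zero => exact inferInstanceAs (⊤ : Subgroup (X _⦋0⦌)).Normal
  | succ n => exact Subgroup.normal_iInf_normal fun i => inferInstance

/-- The boundaries `d_{n+1}(N(X)_{n+1})` are normal in `X_n`. -/
instance normal_map_moore (X : SimpGrp.{u}) (n : ℕ) :
    ((moore X (n + 1)).map (X.δ (Fin.last (n + 1))).hom).Normal :=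
  Subgroup.Normal.map inferInstance _ fun x =>
    -- The degeneracy `s_n` splits `d_{n+1}`, and surjective homomorphisms preserve normality.
    ⟨(X.σ (Fin.last n)).hom x, ConcreteCategory.congr_hom (X.δ_comp_σ_succ (i := Fin.last n)) x⟩

theorem mem_map_moore_of_mem_cotKer {n : ℕ} (X : SimpGrp.{u}) {x : X _⦋n⦌}
    (hx : x ∈ cotKer n X (op ⦋n⦌)) :
    x ∈ (moore X (n + 1)).map (X.δ (Fin.last (n + 1))).hom := by
  have : cotKer n X (op ⦋n⦌) ≤ (moore X (n + 1)).map (X.δ (Fin.last (n + 1))).hom := by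
    refine Subgroup.normalClosure_le_normal ?_
    rintro _ ⟨k, hk, f, z, hz, rfl⟩
    exact map_mem_map_moore X hk hz f.unop
  exact this hx

/-- `Cot_n(X)` vanishes iff `N(X)` vanishes below `n` and `d_{n+1}` is onto `N(X)_n`. -/
theorem kerCot_iff (n : ℕ) (X : SimpGrp.{u}) :
    KerCot n X ↔ MooreGE n X ∧
      moore X n ≤ (moore X (n + 1)).map (X.δ (Fin.last (n + 1))).hom := by
  have hz : KerCot n X ↔ ∀ m (x : X.obj m), x ∈ cotKer n X m := by
    rw [KerCot, isZero_functor_grpCat_iff]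
    refine forall_congr' fun m => ⟨fun h x => ?_, fun h q => ?_⟩
    · exact (QuotientGroup.eq_one_iff x).1 (h (QuotientGroup.mk x))
    · obtain ⟨x, rfl⟩ := QuotientGroup.mk_surjective q
      exact (QuotientGroup.eq_one_iff x).2 (h x)
  rw [hz]
  constructor
  · intro h
    exact ⟨fun j hj => (Subgroup.eq_bot_iff_forall _).2 fun x _ =>
      eq_one_of_mem_cotKer hj X (h _ x), fun x _ => mem_map_moore_of_mem_cotKer X (h _ x)⟩
  · rintro ⟨h1, h2⟩ m x
    -- The kernel contains all Moore elements: those below `n` are trivial, those in dimension `n`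
    -- are boundaries of generators, those above are generators.
    have := eq_top_of_moore_le X (cotKer n X) (cotKer_le_comap_map n X) m.unop.len (by
      intro j _
      rcases lt_trichotomy j n with hj | rfl | hj
      · rw [h1 j hj]
        exact bot_le
      · intro z hz
        obtain ⟨w, hw, rfl⟩ := h2 hz
        exact Subgroup.subset_normalClosure ⟨j + 1, by omega, _, w, hw, rfl⟩
      · exact fun z hz => Subgroup.subset_normalClosure ⟨j, hj, 𝟙 _, z, hz, by simp⟩)
    exact this.ge (Subgroup.mem_top x)

/-! ### Normal simplicial subgroups -/

/-- A normal simplicial subgroup of a simplicial group. -/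
structure NormalSimplicialSubgroup (X : SimpGrp.{u}) where
  carrier : ∀ m : SimplexCategoryᵒᵖ, Subgroup (X.obj m)
  le_comap_map : ∀ {m m' : SimplexCategoryᵒᵖ} (f : m ⟶ m'),
    carrier m ≤ (carrier m').comap (X.map f).hom
  normal : ∀ m, (carrier m).Normal

namespace NormalSimplicialSubgroup

variable {X : SimpGrp.{u}} (L : NormalSimplicialSubgroup X)

attribute [instance] NormalSimplicialSubgroup.normal

/-- A normal simplicial subgroup as a simplicial group. -/
def toSimpGrp : SimpGrp.{u} where
  obj m := GrpCat.of (L.carrier m)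
  map {m m'} f := GrpCat.ofHom
    (((X.map f).hom.comp (L.carrier m).subtype).codRestrict (L.carrier m')
      fun x => L.le_comap_map f x.2)
  map_id m := by
    ext x
    exact ConcreteCategory.congr_hom (X.map_id m) x.1
  map_comp f g := by
    ext x
    exact ConcreteCategory.congr_hom (X.map_comp f g) x.1

/-- The inclusion of a normal simplicial subgroup. -/
def ι : L.toSimpGrp ⟶ X where
  app m := GrpCat.ofHom (L.carrier m).subtype
  naturality _ _ _ := rfl

/-- The quotient by a normal simplicial subgroup. -/
def quotient : SimpGrp.{u} where
  obj m := GrpCat.of (X.obj m ⧸ L.carrier m)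
  map f := GrpCat.ofHom (QuotientGroup.map _ _ (X.map f).hom (L.le_comap_map f))
  map_id m := by
    ext x
    simp
  map_comp f g := by
    ext x
    simp

/-- The projection onto the quotient by a normal simplicial subgroup. -/
def π : X ⟶ L.quotient where
  app m := GrpCat.ofHom (QuotientGroup.mk' (L.carrier m))
  naturality _ _ _ := rfl

theorem ι_comp_π : L.ι ≫ L.π = 0 := by
  ext m x
  exact (QuotientGroup.eq_one_iff _).2 x.2

theorem isShortExactSeq : IsShortExactSeq L.ι L.π := by
  refine ⟨L.ι_comp_π, ⟨?_⟩, ⟨?_⟩⟩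
  · have hmem : ∀ {W : SimpGrp.{u}} (g : W ⟶ X) (_ : g ≫ L.π = 0) (m) (w : W.obj m),
        (g.app m).hom w ∈ L.carrier m := fun g hg m w =>
      (QuotientGroup.eq_one_iff _).1 (ConcreteCategory.congr_hom (congr_app hg m) w)
    refine KernelFork.IsLimit.ofι _ _
      (fun {W} g hg =>
        { app := fun m => GrpCat.ofHom ((g.app m).hom.codRestrict (L.carrier m) (hmem g hg m))
          naturality := fun m m' f => ?_ }) (fun g hg => ?_) (fun {W} g hg a ha => ?_)
    · ext w
      exact Subtype.ext (ConcreteCategory.congr_hom (g.naturality f) w)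
    · rfl
    · subst ha
      rfl
  · have hker : ∀ {Z : SimpGrp.{u}} (g : X ⟶ Z) (_ : L.ι ≫ g = 0) (m),
        L.carrier m ≤ (g.app m).hom.ker := fun g hg m x hx =>
      DFunLike.congr_fun (congrArg GrpCat.Hom.hom (congr_app hg m)) (⟨x, hx⟩ : L.carrier m)
    refine CokernelCofork.IsColimit.ofπ _ _
      (fun {Z} g hg =>
        { app := fun m => GrpCat.ofHom (QuotientGroup.lift _ (g.app m).hom (hker g hg m))
          naturality := fun m m' f => ?_ }) (fun g hg => ?_) (fun {Z} g hg a ha => ?_)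
    · ext q
      obtain ⟨x, rfl⟩ := QuotientGroup.mk_surjective q
      exact ConcreteCategory.congr_hom (g.naturality f) x
    · rfl
    · subst ha
      ext m q
      obtain ⟨x, rfl⟩ := QuotientGroup.mk_surjective q
      rfl

theorem mem_moore_iff (k : ℕ) (z : L.toSimpGrp _⦋k⦌) :
    z ∈ moore L.toSimpGrp k ↔ (L.ι.app (op ⦋k⦌)).hom z ∈ moore X k := by
  cases k with
  | zero => exact ⟨fun _ => trivial, fun _ => trivial⟩
  | succ k =>
    rw [mem_moore_succ, mem_moore_succ]
    exact forall_congr' fun i => Subtype.ext_iff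

end NormalSimplicialSubgroup

/-! ### The torsion theory of the cotruncation -/

/-- The kernel of `X ⟶ Cot_n(X)`. -/
def cotKernel (n : ℕ) (X : SimpGrp.{u}) : NormalSimplicialSubgroup X where
  carrier := cotKer n X
  le_comap_map := cotKer_le_comap_map n X
  normal _ := inferInstance

/-- All of `N(X)_{n+1}` lies in the kernel, so the boundary preimages needed in dimension `n` are
found inside it. -/
theorem kerCot_cotKernel (n : ℕ) (X : SimpGrp.{u}) : KerCot n (cotKernel n X).toSimpGrp := by
  rw [kerCot_iff]
  refine ⟨fun j hj => (Subgroup.eq_bot_iff_forall _).2 fun z _ =>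
    Subtype.ext (eq_one_of_mem_cotKer hj X z.2), fun z hz => ?_⟩
  obtain ⟨w, hw, h⟩ := mem_map_moore_of_mem_cotKer X z.2
  have hw' : w ∈ cotKer n X (op ⦋n + 1⦌) :=
    Subgroup.subset_normalClosure ⟨n + 1, by omega, 𝟙 _, w, hw, by simp⟩
  exact ⟨(⟨w, hw'⟩ : cotKer n X (op ⦋n + 1⦌)),
    ((cotKernel n X).mem_moore_iff _ _).2 hw, Subtype.ext h⟩

/-- The torsion theory `(Ker(Cot_n), M_{n ≥})`. -/
def cotTorsionTheory (n : ℕ) : TorsionTheory SimpGrp.{u} where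
  torsion := KerCot n
  torsionFree := MooreLE n
  torsion_replete := ⟨fun e h => IsZero.of_iso h ((cot n).mapIso e).symm⟩
  torsionFree_replete := ⟨fun {X Y} e h i hi => (Subgroup.eq_bot_iff_forall _).2 fun y hy => by
    have h1 : (e.inv.app (op ⦋i⦌)).hom y = 1 := by
      have := moore_le_comap i e.inv hy
      rwa [h i hi] at this
    have h2 := ConcreteCategory.congr_hom (congr_app e.inv_hom_id (op ⦋i⦌)) y
    exact h2.symm.trans ((congrArg (e.hom.app (op ⦋i⦌)).hom h1).trans (map_one _))⟩
  hom_eq_zero {T F} hT hF f := by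
    obtain ⟨ψ, rfl, -⟩ := cot_universal n hF f
    rw [IsZero.eq_zero_of_src hT ψ, comp_zero]
  exists_shortExact X := ⟨_, _, _, _, kerCot_cotKernel n X, mooreLE_cot n X,
    (cotKernel n X).isShortExactSeq⟩

/-! ### The torsion theory of the truncation -/

/-- The elements of a simplicial group whose images in dimensions `≤ n` are trivial. -/
def truncationKernel (n : ℕ) (X : SimpGrp.{u}) : NormalSimplicialSubgroup X where
  carrier m := ⨅ (j : ℕ) (_ : j ≤ n) (f : m ⟶ op ⦋j⦌), (X.map f).hom.ker
  le_comap_map {m m'} f x hx := by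
    simp only [Subgroup.mem_comap, Subgroup.mem_iInf, MonoidHom.mem_ker] at hx ⊢
    intro j hj g
    simpa using hx j hj (f ≫ g)
  normal m := Subgroup.normal_iInf_normal fun j => Subgroup.normal_iInf_normal fun hj =>
    Subgroup.normal_iInf_normal fun f => inferInstance

theorem mem_truncationKernel {n : ℕ} {X : SimpGrp.{u}} {m : SimplexCategoryᵒᵖ} {x : X.obj m} :
    x ∈ (truncationKernel n X).carrier m ↔
      ∀ j ≤ n, ∀ f : m ⟶ op ⦋j⦌, (X.map f).hom x = 1 := by
  simp [truncationKernel, Subgroup.mem_iInf, MonoidHom.mem_ker]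

theorem kerTr_truncationKernel (n : ℕ) (X : SimpGrp.{u}) :
    KerTr n (truncationKernel n X).toSimpGrp := by
  rw [kerTr_eq_mooreGE, mooreGE_succ_iff]
  intro m hm x
  refine Subtype.ext (?_ : x.1 = 1)
  simpa using mem_truncationKernel.1 x.2 m hm (𝟙 _)

/-- Composing with the unit gives the adjoint transpose of the truncated morphism. -/
theorem comp_coskAdj_unit_eq_iff (n : ℕ) {X Y : SimpGrp.{u}} (f g : X ⟶ Y) :
    f ≫ (SimplicialObject.coskAdj n).unit.app Y = g ≫ (SimplicialObject.coskAdj n).unit.app Y ↔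
      (SimplicialObject.truncation n).map f = (SimplicialObject.truncation n).map g := by
  rw [← Adjunction.homEquiv_id, ← Adjunction.homEquiv_naturality_left,
    ← Adjunction.homEquiv_naturality_left, Equiv.apply_eq_iff_eq, Category.comp_id,
    Category.comp_id]

/-- A morphism from an object with zero truncation to an object with monic unit is zero. -/
theorem eq_zero_of_kerTr_of_monoCoskUnit {n : ℕ} {T F : SimpGrp.{u}} (hT : KerTr n T)
    (hF : MonoCoskUnit n F) (f : T ⟶ F) : f = 0 := by
  have : Mono ((SimplicialObject.coskAdj n).unit.app F) := hF
  rw [← cancel_mono ((SimplicialObject.coskAdj n).unit.app F)]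
  exact (comp_coskAdj_unit_eq_iff n f 0).2 (IsZero.eq_of_src hT _ _)

/-- If `a` and `b` have equal truncations, every operator into dimension at most `n` kills `a(z)
b(z)⁻¹`. -/
theorem monoCoskUnit_of_truncationKernel {n : ℕ} {X : SimpGrp.{u}}
    (h : ∀ m, (truncationKernel n X).carrier m = ⊥) : MonoCoskUnit n X := by
  refine ⟨fun {Z} a b hab => ?_⟩
  replace hab := (comp_coskAdj_unit_eq_iff n a b).1 hab
  ext m z
  rw [← mul_inv_eq_one, ← Subgroup.mem_bot, ← h m, mem_truncationKernel]
  intro j hj f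
  have hj' : a.app (op ⦋j⦌) = b.app (op ⦋j⦌) := congr_app hab (op ⟨⦋j⦌, hj⟩)
  have ha := ConcreteCategory.congr_hom (a.naturality f) z
  have hb := ConcreteCategory.congr_hom (b.naturality f) z
  rw [← hj'] at hb
  rw [map_mul, map_inv, mul_inv_eq_one]
  exact ha.symm.trans hb

/-- In dimensions at most `n` the subgroup is trivial (take the identity operator), so an operator
landing there kills a class only if it kills its representative. -/
theorem monoCoskUnit_quotient (n : ℕ) (X : SimpGrp.{u}) :
    MonoCoskUnit n (truncationKernel n X).quotient := by
  refine monoCoskUnit_of_truncationKernel fun m => (Subgroup.eq_bot_iff_forall _).2 fun q hq => ?_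
  obtain ⟨x, rfl⟩ := QuotientGroup.mk_surjective q
  replace hq := mem_truncationKernel.1 hq
  refine (QuotientGroup.eq_one_iff _).2 (mem_truncationKernel.2 fun j hj f => ?_)
  have := mem_truncationKernel.1 ((QuotientGroup.eq_one_iff _).1 (hq j hj f)) j hj (𝟙 _)
  simpa using this

/-- The torsion theory `(Ker(tr_n), F_{tr_n})`. -/
def truncationTorsionTheory (n : ℕ) : TorsionTheory SimpGrp.{u} where
  torsion := KerTr n
  torsionFree := MonoCoskUnit n
  torsion_replete := ⟨fun e h => IsZero.of_iso h ((SimplicialObject.truncation n).mapIso e).symm⟩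
  torsionFree_replete := ⟨fun {X Y} e h => by
    have : Mono ((SimplicialObject.coskAdj n).unit.app X) := h
    have hY := (SimplicialObject.coskAdj n).unit.naturality e.inv
    have : Mono ((SimplicialObject.coskAdj n).unit.app Y ≫
        (SimplicialObject.truncation n ⋙ SimplicialObject.Truncated.cosk n).map e.inv) := by
      rw [← hY]
      exact mono_comp _ _
    exact mono_of_mono _ ((SimplicialObject.truncation n ⋙
      SimplicialObject.Truncated.cosk n).map e.inv)⟩
  hom_eq_zero := eq_zero_of_kerTr_of_monoCoskUnit
  exists_shortExact X := ⟨_, _, _, _, kerTr_truncationKernel n X, monoCoskUnit_quotient n X,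
    (truncationKernel n X).isShortExactSeq⟩

/-! ### The chain of torsion theories -/

theorem kerCot_le_mooreGE (n : ℕ) : KerCot.{u} n ≤ MooreGE n :=
  fun X h => ((kerCot_iff n X).1 h).1

/-- Here `N(X)_n` is trivial, so surjectivity of `d_{n+1}` onto it is automatic. -/
theorem mooreGE_succ_le_kerCot (n : ℕ) : MooreGE.{u} (n + 1) ≤ KerCot n := fun X h =>
  (kerCot_iff n X).2 ⟨fun j hj => h j (by omega), by rw [h n (by omega)]; exact bot_le⟩

theorem cotTorsionTheory_succ_le (n : ℕ) :
    cotTorsionTheory.{u} (n + 1) ≤ truncationTorsionTheory n :=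
  (kerCot_le_mooreGE (n + 1)).trans (kerTr_eq_mooreGE n).ge

theorem truncationTorsionTheory_le (n : ℕ) :
    truncationTorsionTheory.{u} n ≤ cotTorsionTheory n :=
  (kerTr_eq_mooreGE n).le.trans (mooreGE_succ_le_kerCot n)

theorem antitone_cotTorsionTheory : Antitone cotTorsionTheory.{u} :=
  antitone_nat_of_succ_le fun n =>
    (cotTorsionTheory_succ_le n).trans (truncationTorsionTheory_le n)

theorem antitone_truncationTorsionTheory : Antitone truncationTorsionTheory.{u} :=
  antitone_nat_of_succ_le fun n =>
    (truncationTorsionTheory_le (n + 1)).trans (cotTorsionTheory_succ_le n)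

theorem cotTorsionTheory_le_or_le (a b : ℕ) :
    cotTorsionTheory.{u} a ≤ truncationTorsionTheory b ∨
      truncationTorsionTheory.{u} b ≤ cotTorsionTheory a := by
  rcases lt_or_ge b a with h | h
  · exact .inl ((antitone_cotTorsionTheory h).trans (cotTorsionTheory_succ_le b))
  · exact .inr ((truncationTorsionTheory_le b).trans (antitone_cotTorsionTheory h))

theorem isChain_torsionTheories :
    IsChain (· ≤ ·) ({⊥, ⊤} ∪ Set.range cotTorsionTheory.{u} ∪
      Set.range truncationTorsionTheory.{u}) := by
  -- Pairs involving `⊥` or `⊤` are immediate; four cases within or between the two families remain.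
  rintro σ ((( rfl | rfl) | ⟨a, rfl⟩) | ⟨a, rfl⟩) τ (((rfl | rfl) | ⟨b, rfl⟩) | ⟨b, rfl⟩) -
  any_goals first
    | exact .inl bot_le
    | exact .inl le_top
    | exact .inr bot_le
    | exact .inr le_top
  · exact (le_total b a).imp (antitone_cotTorsionTheory ·) (antitone_cotTorsionTheory ·)
  · exact cotTorsionTheory_le_or_le a b
  · exact (cotTorsionTheory_le_or_le b a).symm
  · exact (le_total b a).imp (antitone_truncationTorsionTheory ·)
      (antitone_truncationTorsionTheory ·)

/-- A chain contains the meet and the join of any two of its elements. -/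
theorem IsChain.exists_isGLB_and_isLUB {α : Type*} [PartialOrder α] {S : Set α}
    (hS : IsChain (· ≤ ·) S) {a b : α} (ha : a ∈ S) (hb : b ∈ S) :
    (∃ c ∈ S, IsGLB {a, b} c) ∧ ∃ c ∈ S, IsLUB {a, b} c := by
  rcases hS.total ha hb with h | h
  · exact ⟨⟨a, ha, IsLeast.isGLB ⟨by simp, by simp [h]⟩⟩,
      b, hb, IsGreatest.isLUB ⟨by simp, by simp [h]⟩⟩
  · exact ⟨⟨b, hb, IsLeast.isGLB ⟨by simp, by simp [h]⟩⟩,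
      a, ha, IsGreatest.isLUB ⟨by simp, by simp [h]⟩⟩

theorem mainTheorem2 :
    ∃ muLE muGESucc : ℕ → TorsionTheory SimpGrp.{u},
      -- `muLE n` is `(Ker(Cot_n), M_{n ≥})`
      (∀ n, (muLE n).torsion = KerCot n ∧ (muLE n).torsionFree = MooreLE n) ∧
      -- `muGESucc n` is the torsion theory of index `≥ n + 1`, with torsion part `M_{≥ n+1}`
      (∀ n, (muGESucc n).torsion = KerTr n ∧ (muGESucc n).torsionFree = MonoCoskUnit n ∧
        KerTr.{u} n = MooreGE (n + 1)) ∧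
      -- the chain of torsion subcategories
      (∀ n, (IsZero : ObjectProperty SimpGrp.{u}) ≤ KerCot (n + 1) ∧
        KerCot.{u} (n + 1) ≤ MooreGE (n + 1) ∧ MooreGE.{u} (n + 1) ≤ KerCot n ∧
        KerCot.{u} n ≤ MooreGE n ∧ MooreGE.{u} n ≤ ⊤) ∧
      -- the chain of torsion theories
      (∀ n, ⊥ ≤ muLE (n + 1) ∧ muLE (n + 1) ≤ muGESucc n ∧ muGESucc n ≤ muLE n ∧ muLE n ≤ ⊤) ∧
      -- the torsion theories form a linearly ordered lattice with least and greatest element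
      (∀ S : Set (TorsionTheory SimpGrp.{u}),
        S = {⊥, ⊤} ∪ Set.range muLE ∪ Set.range muGESucc →
          IsChain (· ≤ ·) S ∧ IsLeast S ⊥ ∧ IsGreatest S ⊤ ∧
          ∀ σ ∈ S, ∀ τ ∈ S, (∃ ρ ∈ S, IsGLB {σ, τ} ρ) ∧ ∃ ρ ∈ S, IsLUB {σ, τ} ρ) := by
  refine ⟨cotTorsionTheory, truncationTorsionTheory, fun n => ⟨rfl, rfl⟩,
    fun n => ⟨rfl, rfl, kerTr_eq_mooreGE n⟩,
    -- The order compares torsion parts and that of `⊥` is `IsZero`, so this is the inclusion of the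
    -- zero objects.
    fun n => ⟨bot_le (a := cotTorsionTheory (n + 1)), kerCot_le_mooreGE _,
      mooreGE_succ_le_kerCot n, kerCot_le_mooreGE n, le_top⟩,
    fun n => ⟨bot_le, cotTorsionTheory_succ_le n, truncationTorsionTheory_le n, le_top⟩, ?_⟩
  rintro S rfl
  exact ⟨isChain_torsionTheories, ⟨by simp, fun _ _ => bot_le⟩, ⟨by simp, fun _ _ => le_top⟩,
    fun σ hσ τ hτ => isChain_torsionTheories.exists_isGLB_and_isLUB hσ hτ⟩
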